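/- Let $r\in\mathbb N$. There are a constant $C(r)>0$ and a threshold $n_*(r)$, both depending only on $r$, such that the following holds. Let $1<t_0<N_0$ be integers, put $\alpha=\log t_0/\log N_0$, assume $r>1/\alpha$, let $n_0\ge n_*(r)$ be an integer, and set $N=N_0^{2n_0}$, $t=t_0^{2n_0}$ and $[N]=\{0,1,\dots,N-1\}$. Let $P\subset[N]$ be an arithmetic progression of length $t^{1/2}=t_0^{n_0}$, and let $P_0=\{0\}$, $P_{j+1}=\bigcup_{a\in P_j}(a+N^{-(j+1)}P)$. Let $A_0=\{0\}$ and $A_{j+1}=\bigcup_{a\in A_j}(a+A_{j+1,a})$ for $j\ge0$, where the sets $A_{j+1,a}\subset N^{-(j+1)}[N]$ are arbitrary with $|A_{j+1,a}|=t$, subject to $P_j\subset A_j$ for all $j$. Let $\mu_j$ be the measure on $\mathbb R$ with density $$\frac{d\mu_j}{dx}=\sum_{a\in A_j}t^{-j}N^j\,\mathbf 1_{[a,a+N^{-j}]},$$ and let $f_\ell=\mathbf 1_{F_\ell}$, where $F_\ell=\bigcup_{a\in P_\ell}[a,a+N^{-\ell})$. Then the measures $\mu_j$ converge weakly to a probability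 measure $\mu$, and for every real $p$ with $1\le p\le 2r$ and for all sufficiently large $\ell$, $$\big\|\widehat{f_\ell\,d\mu}\big\|_{L^p(\mathbb R)}^p\ \ge\ C(r)\,\frac{N^\ell\, r^{-\ell-1}}{t^{\ell(p+1)/2}},$$ where $\widehat{f_\ell\,d\mu}(\xi)=\int e^{-2\pi i x\xi}f_\ell(x)\,d\mu(x)$ and the left-hand side is allowed to be $+\infty$. -/

import Mathlib

open MeasureTheory Filter Topology
open scoped BoundedContinuousFunction

noncomputable section

namespace CantorRestriction

open Classical in
/-- The finite sets `A 0 = {0}`, `A (j+1) = ⋃ a ∈ A j, (a + A_{j+1,a})` of left endpoints of a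
Cantor iteration in base `N`. The choice made at step `j` for the point `a ∈ A j` is recorded
by its digit set `D j a`, that is, `A_{j+1,a} = {d / N ^ (j+1) : d ∈ D j a}`. -/
def endpoints (N : ℕ) (D : ℕ → ℝ → Finset ℕ) : ℕ → Finset ℝ
  | 0 => {0}
  | j + 1 => (endpoints N D j).biUnion fun a =>
      (D j a).image fun d : ℕ => a + (d : ℝ) / (N : ℝ) ^ (j + 1)

/-- The choices `D` are admissible: every `A_{j+1,a}` with `a ∈ A j` is a subset of
`N ^ (-(j+1)) {0, …, N-1}` with exactly `t` elements. -/
def Admissible (N t : ℕ) (D : ℕ → ℝ → Finset ℕ) : Prop :=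
  ∀ j : ℕ, ∀ a ∈ endpoints N D j, D j a ⊆ Finset.range N ∧ (D j a).card = t

/-- `P` is an arithmetic progression of length `L` (with `L` distinct terms). -/
def IsArithProg (P : Finset ℕ) (L : ℕ) : Prop :=
  ∃ x d : ℕ, 0 < d ∧ P = (Finset.range L).image fun i => x + i * d

/-- The endpoints `P_j` of the structured Cantor iteration:
`P_0 = {0}`, `P_{j+1} = ⋃ a ∈ P_j, (a + N ^ (-(j+1)) P)`. -/
def structuredEndpoints (N : ℕ) (P : Finset ℕ) : ℕ → Finset ℝ :=
  endpoints N fun _ _ => P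

/-- The absolutely continuous measure `μ_j` on `ℝ` with density
`∑ a ∈ A j, t ^ (-j) * N ^ j * 1_{[a, a + N ^ (-j)]}`. -/
def approxMeasure (N t : ℕ) (D : ℕ → ℝ → Finset ℕ) (j : ℕ) : Measure ℝ :=
  volume.withDensity fun x => ∑ a ∈ endpoints N D j,
    (Set.Icc a (a + ((N : ℝ) ^ j)⁻¹)).indicator
      (fun _ => ENNReal.ofReal (((t : ℝ) ^ j)⁻¹ * (N : ℝ) ^ j)) x

/-- `μ` is a probability measure and the weak limit of the measures `μ_j`. -/
def IsWeakLimit (N t : ℕ) (D : ℕ → ℝ → Finset ℕ) (μ : Measure ℝ) : Prop :=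
  IsProbabilityMeasure μ ∧ ∀ g : ℝ →ᵇ ℝ,
    Tendsto (fun j => ∫ x, g x ∂(approxMeasure N t D j)) atTop (𝓝 (∫ x, g x ∂μ))

/-- The set `F_ℓ = ⋃ a ∈ P_ℓ, [a, a + N ^ (-ℓ))`. -/
def structuredSet (N : ℕ) (P : Finset ℕ) (l : ℕ) : Set ℝ :=
  ⋃ a ∈ structuredEndpoints N P l, Set.Ico a (a + ((N : ℝ) ^ l)⁻¹)

/-- The characteristic function `f_ℓ` of `F_ℓ`. -/
def structuredFun (N : ℕ) (P : Finset ℕ) (l : ℕ) : ℝ → ℂ :=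
  (structuredSet N P l).indicator fun _ => 1

/-- The Fourier transform of the complex measure `f dμ`:
`ξ ↦ ∫ exp (-2 π i x ξ) f(x) dμ(x)`. -/
def fourierMeas (f : ℝ → ℂ) (μ : Measure ℝ) : ℝ → ℂ :=
  Fourier.fourierIntegral Real.fourierChar μ f

end CantorRestriction

end

/-! ### Fourier side: mass, sumset and the `L ^ (2 r)` norm. -/

namespace CantorRestriction

open scoped Manifold ContDiff FourierTransform SchwartzMap

/-! Write `L = t₀ ^ n₀`, so `t = L ^ 2`, and let `ν` be `μ` restricted to `F_l`. The `r`-th power of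
the transform of `ν` is the transform of the law `κ` of a sum of `r` independent `ν`-points.
Plancherel and Cauchy–Schwarz bound `κ(ℝ) ^ 2 = ν(ℝ) ^ (2 r)` by the measure of a neighbourhood `U`
of the support of `κ` times the integral of `|ν̂| ^ (2 r)` (`measure_univ_pow_le`).

The structure of `P` makes `U` small: `r`-fold sums from a progression of length `L` take at most `r
L` values, so the sums of `r` points of `F_l` lie in at most `(r L) ^ l` intervals of length `r N ^
(-l)` (`exists_sum_mem_structuredSet`).

Since `|ν̂| ≤ ν(ℝ)`, the exponent drops from `2 r` to `p` at the cost of `ν(ℝ) ^ (2 r - p)`, leaving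
`ν(ℝ) ^ p ≤ |U| ∫ |ν̂| ^ p`. Finally `ν(ℝ) ≥ L ^ l t ^ (-l) = L ^ (-l)`, because each of the `L ^ l`
cells has mass at least `t ^ (-l)`. For this, `μ` is built as the law of the end of a random branch
with independent uniform choices. -/

/-- A Schwartz function that is equal to `1` on `E` and whose square integral is at most the
measure of `U`. -/
lemma exists_schwartzMap_eq_one_on {E U : Set ℝ} (hE : IsClosed E) (hU : IsOpen U) (hEU : E ⊆ U)
    (hb : Bornology.IsBounded U) :
    ∃ φ : 𝓢(ℝ, ℂ), (∀ x ∈ E, φ x = 1) ∧ ∫⁻ x, ‖φ x‖ₑ ^ 2 ≤ volume U := by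
  obtain ⟨f, hf0, hf1, hf⟩ := exists_contMDiffMap_zero_one_of_isClosed 𝓘(ℝ, ℝ) (n := (⊤ : ℕ∞))
    hU.isClosed_compl hE (Set.disjoint_left.2 fun x hx hx' => hx (hEU hx'))
  have hsupp : Function.support (fun x => (f x : ℂ)) ⊆ U := by
    intro x hx
    by_contra hxU
    exact hx (by simp [hf0 hxU])
  have hcs : HasCompactSupport fun x => (f x : ℂ) :=
    Metric.isCompact_of_isClosed_isBounded (isClosed_tsupport _) (hb.subset hsupp).closure
  have hsm : ContDiff ℝ ∞ fun x => (f x : ℂ) :=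
    Complex.ofRealCLM.contDiff.comp f.contMDiff.contDiff
  refine ⟨hcs.toSchwartzMap hsm, fun x hx => ?_, ?_⟩
  · simp [hf1 hx]
  · calc ∫⁻ x, ‖(hcs.toSchwartzMap hsm) x‖ₑ ^ 2 ≤ ∫⁻ x, U.indicator 1 x := by
          refine lintegral_mono fun x => ?_
          by_cases hx : x ∈ U
          · have h1 : ‖(f x : ℂ)‖ₑ ≤ 1 := by
              rw [← ofReal_norm, Complex.norm_real, Real.norm_eq_abs, abs_of_nonneg (hf x).1]
              exact ENNReal.ofReal_le_one.2 (hf x).2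
            simpa [hx] using pow_le_one' h1 2
          · simp [hx, hf0 hx]
      _ = volume U := by rw [lintegral_indicator_one hU.measurableSet]

lemma lintegral_enorm_sq_fourier (f : 𝓢(ℝ, ℂ)) :
    ∫⁻ x, ‖𝓕 f x‖ₑ ^ 2 = ∫⁻ x, ‖f x‖ₑ ^ 2 := by
  have key : ∀ g : 𝓢(ℝ, ℂ), ∫⁻ x, ‖g x‖ₑ ^ 2 = ENNReal.ofReal (∫ x, ‖g x‖ ^ 2) := by
    intro g
    rw [ofReal_integral_eq_lintegral_ofReal]
    · simp [ENNReal.ofReal_pow]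
    · exact (memLp_two_iff_integrable_sq_norm g.continuous.aestronglyMeasurable).1 (g.memLp 2)
    · exact Eventually.of_forall fun x => by positivity
  rw [key, key, SchwartzMap.integral_norm_sq_fourier]

/-- A finite measure carried by a closed set `E` is controlled by the square integral of its Fourier
transform and the measure of any bounded neighbourhood of `E`. -/
lemma measure_univ_sq_le (ν : Measure ℝ) [IsFiniteMeasure ν] {E U : Set ℝ} (hE : IsClosed E)
    (hU : IsOpen U) (hEU : E ⊆ U) (hb : Bornology.IsBounded U) (hν : ∀ᵐ x ∂ν, x ∈ E) :
    ν Set.univ ^ 2 ≤ volume U *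
      ∫⁻ ξ, ‖Fourier.fourierIntegral Real.fourierChar ν (fun _ => (1 : ℂ)) ξ‖ₑ ^ 2 := by
  obtain ⟨φ, hφ1, hφ⟩ := exists_schwartzMap_eq_one_on hE hU hEU hb
  set F := Fourier.fourierIntegral Real.fourierChar ν (fun _ => (1 : ℂ)) with hF
  set ψ : 𝓢(ℝ, ℂ) := 𝓕⁻ φ with hψ
  have hφψ : 𝓕 ψ = φ := FourierTransform.fourier_fourierInv_eq φ
  -- Multiplication formula: the integral of `φ = 𝓕 ψ` against `ν`, which is the total mass, equals
  -- the Lebesgue integral of `ψ * F`.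
  have hflip := VectorFourier.integral_fourierIntegral_smul_eq_flip (μ := volume) (ν := ν)
    (L := LinearMap.mul ℝ ℝ) (e := Real.fourierChar) (f := ψ) (g := fun _ => (1 : ℂ))
    Real.continuous_fourierChar (by exact continuous_mul) ψ.integrable (integrable_const _)
  have hl : ∫ ξ, VectorFourier.fourierIntegral Real.fourierChar volume (LinearMap.mul ℝ ℝ) ψ ξ •
      (1 : ℂ) ∂ν = ν.real Set.univ := by
    have : ∀ᵐ ξ ∂ν, VectorFourier.fourierIntegral Real.fourierChar volume (LinearMap.mul ℝ ℝ) ψ ξ •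
      (1 : ℂ) = 1 := by
      filter_upwards [hν] with ξ hξ
      have h1 : 𝓕 ψ ξ = 1 := by rw [hφψ, hφ1 ξ hξ]
      rw [SchwartzMap.fourier_coe, Real.fourier_eq] at h1
      simpa [VectorFourier.fourierIntegral, mul_comm] using h1
    rw [integral_congr_ae this]
    simp
  have hr : ∀ x, VectorFourier.fourierIntegral Real.fourierChar ν (LinearMap.mul ℝ ℝ).flip
      (fun _ => (1 : ℂ)) x = F x := by
    intro x
    simp [hF, Fourier.fourierIntegral, VectorFourier.fourierIntegral, mul_comm]
  rw [hl] at hflip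
  simp_rw [hr] at hflip
  have hFm : AEMeasurable (fun x => ‖F x‖ₑ) volume := by
    refine Continuous.aemeasurable (Continuous.enorm ?_)
    exact VectorFourier.fourierIntegral_continuous Real.continuous_fourierChar
      (by exact continuous_mul) (integrable_const _)
  have hle : ν Set.univ ≤ ∫⁻ x, ‖ψ x‖ₑ * ‖F x‖ₑ := by
    calc ν Set.univ = ‖((ν.real Set.univ : ℝ) : ℂ)‖ₑ := by
          rw [← ofReal_norm, Complex.norm_real, Real.norm_of_nonneg measureReal_nonneg,
            ofReal_measureReal]
      _ ≤ ∫⁻ x, ‖ψ x • F x‖ₑ := by rw [hflip]; exact enorm_integral_le_lintegral_enorm _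
      _ = _ := by simp
  have hCS := ENNReal.lintegral_mul_le_Lp_mul_Lq volume Real.HolderConjugate.two_two
    (f := fun x => ‖ψ x‖ₑ) (g := fun x => ‖F x‖ₑ) ψ.continuous.enorm.aemeasurable hFm
  have hψ2 : ∫⁻ x, ‖ψ x‖ₑ ^ 2 ≤ volume U := by
    rw [← lintegral_enorm_sq_fourier, hφψ]; exact hφ
  have hsq : ∀ a : ENNReal, (a ^ (1 / 2 : ℝ)) ^ 2 = a := by
    intro a
    rw [← ENNReal.rpow_natCast, ← ENNReal.rpow_mul]
    norm_num
  calc ν Set.univ ^ 2 ≤ (∫⁻ x, ‖ψ x‖ₑ * ‖F x‖ₑ) ^ 2 := by gcongr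
    _ ≤ ((∫⁻ x, ‖ψ x‖ₑ ^ (2 : ℝ)) ^ (1 / 2 : ℝ) * (∫⁻ x, ‖F x‖ₑ ^ (2 : ℝ)) ^ (1 / 2 : ℝ)) ^ 2 := by
        gcongr; exact hCS
    _ = (∫⁻ x, ‖ψ x‖ₑ ^ 2) * ∫⁻ x, ‖F x‖ₑ ^ 2 := by
        rw [mul_pow, hsq, hsq]; simp
    _ ≤ _ := by gcongr

/-- The bound of the `L ^ (2 r)` norm of the Fourier transform of `ν` from below through the
support of the law of a sum of `r` independent points. -/
lemma measure_univ_pow_le (ν : Measure ℝ) [IsFiniteMeasure ν] (r : ℕ) {F E U : Set ℝ}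
    (hE : IsClosed E) (hU : IsOpen U) (hEU : E ⊆ U) (hb : Bornology.IsBounded U)
    (hν : ∀ᵐ x ∂ν, x ∈ F) (hsum : ∀ x : Fin r → ℝ, (∀ i, x i ∈ F) → ∑ i, x i ∈ E) :
    ν Set.univ ^ (2 * r) ≤ volume U *
      ∫⁻ ξ, ‖Fourier.fourierIntegral Real.fourierChar ν (fun _ => (1 : ℂ)) ξ‖ₑ ^ (2 * r) := by
  set S : (Fin r → ℝ) → ℝ := fun x => ∑ i, x i with hS
  have hSm : Measurable S := by fun_prop
  set κ : Measure ℝ := (Measure.pi fun _ : Fin r => ν).map S with hκ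
  have : IsFiniteMeasure κ := by rw [hκ]; infer_instance
  have hκE : ∀ᵐ x ∂κ, x ∈ E := by
    refine (ae_map_iff (p := fun y => y ∈ E) hSm.aemeasurable hE.measurableSet).2 ?_
    have : ∀ᵐ x ∂(Measure.pi fun _ : Fin r => ν), ∀ i, x i ∈ F :=
      ae_all_iff.2 fun i => Measure.tendsto_eval_ae_ae.eventually hν
    filter_upwards [this] with x hx using hsum x hx
  have hκu : κ Set.univ = ν Set.univ ^ r := by
    rw [hκ, Measure.map_apply hSm MeasurableSet.univ, Set.preimage_univ, Measure.pi_univ]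
    simp
  have hκF : ∀ ξ, Fourier.fourierIntegral Real.fourierChar κ (fun _ => (1 : ℂ)) ξ =
      Fourier.fourierIntegral Real.fourierChar ν (fun _ => (1 : ℂ)) ξ ^ r := by
    intro ξ
    rw [Fourier.fourierIntegral_def, Fourier.fourierIntegral_def, hκ,
      integral_map hSm.aemeasurable]
    -- The character of a sum is the product of the characters, so the integral over the product
    -- measure factors.
    · have := integral_fintype_prod_eq_pow (μ := ν) (ι := Fin r) (𝕜 := ℂ)
        (fun v : ℝ => Real.fourierChar (-(v * ξ)) • (1 : ℂ))
      rw [Fintype.card_fin] at this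
      rw [← this]
      congr 1 with x
      simp only [hS, Finset.sum_mul, ← Finset.sum_neg_distrib, Circle.smul_def, smul_eq_mul,
        mul_one, Real.fourierChar_apply, ← Complex.exp_sum]
      push_cast
      rw [Finset.mul_sum, Finset.sum_mul]
    · refine Continuous.aestronglyMeasurable ?_
      have := Real.continuous_fourierChar
      fun_prop
  have h := measure_univ_sq_le κ hE hU hEU hb hκE
  simp_rw [hκF, hκu] at h
  simpa [enorm_pow, ← pow_mul, mul_comm] using h

end CantorRestriction

/-! ### Combinatorics of the endpoint sets. -/

namespace CantorRestriction

variable {N t : ℕ} {D : ℕ → ℝ → Finset ℕ}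

lemma mem_endpoints_succ {j : ℕ} {x : ℝ} :
    x ∈ endpoints N D (j + 1) ↔
      ∃ a ∈ endpoints N D j, ∃ d ∈ D j a, a + (d : ℝ) / (N : ℝ) ^ (j + 1) = x := by
  simp [endpoints]

lemma exists_nat_of_mem_endpoints (hN : 0 < N) {j : ℕ} {a : ℝ} (ha : a ∈ endpoints N D j) :
    ∃ k : ℕ, a * (N : ℝ) ^ j = k := by
  induction j generalizing a with
  | zero => exact ⟨0, by simpa [endpoints] using ha⟩
  | succ j ih =>
    obtain ⟨b, hb, d, -, rfl⟩ := mem_endpoints_succ.1 ha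
    obtain ⟨k, hk⟩ := ih hb
    refine ⟨k * N + d, ?_⟩
    have : (N : ℝ) ≠ 0 := by positivity
    push_cast
    rw [← hk]
    field_simp
    ring

/-- Scaled by `N ^ j`, endpoints are integers, and uniqueness of the last base-`N` digit keeps the
children of distinct points distinct. -/
lemma card_endpoints (hN : 0 < N) (hD : Admissible N t D) (j : ℕ) :
    (endpoints N D j).card = t ^ j := by
  have hN0 : (N : ℝ) ≠ 0 := by positivity
  induction j with
  | zero => simp [endpoints]
  | succ j ih =>
    rw [endpoints, Finset.card_biUnion]
    · rw [Finset.sum_congr rfl (g := fun _ => t), Finset.sum_const, ih, smul_eq_mul, pow_succ]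
      intro a ha
      rw [Finset.card_image_of_injective _ fun d e h => ?_, (hD j a ha).2]
      simpa [hN0] using h
    · intro a ha b hb hab
      rw [Function.onFun, Finset.disjoint_left]
      intro x hx hx'
      obtain ⟨d, hd, rfl⟩ := Finset.mem_image.1 hx
      obtain ⟨e, he, h⟩ := Finset.mem_image.1 hx'
      obtain ⟨k, hk⟩ := exists_nat_of_mem_endpoints hN ha
      obtain ⟨m, hm⟩ := exists_nat_of_mem_endpoints hN hb
      have hd' := Finset.mem_range.1 ((hD j a ha).1 hd)
      have he' := Finset.mem_range.1 ((hD j b hb).1 he)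
      have hkm : m * N + e = k * N + d := by
        have : ((m * N + e : ℕ) : ℝ) = (k * N + d : ℕ) := by
          push_cast
          rw [← hk, ← hm]
          field_simp at h
          linear_combination h
        exact_mod_cast this
      have : k = m := by
        have h1 := congrArg (· / N) hkm
        simpa [Nat.add_div_of_dvd_right, Nat.mul_add_div, mul_comm _ N, hN,
          Nat.div_eq_of_lt hd', Nat.div_eq_of_lt he'] using h1.symm
      apply hab
      subst this
      exact mul_right_cancel₀ (pow_ne_zero j hN0) (hk.trans hm.symm)

/-- Only an upper bound: the digits may exceed `N - 1`, as sums of `r` digits do, so children may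
collide. -/
lemma card_endpoints_const_le (Q : Finset ℕ) (j : ℕ) :
    (endpoints N (fun _ _ => Q) j).card ≤ Q.card ^ j := by
  induction j with
  | zero => simp [endpoints]
  | succ j ih =>
    rw [endpoints, pow_succ]
    refine Finset.card_biUnion_le.trans ?_
    calc _ ≤ ∑ _a ∈ endpoints N (fun _ _ => Q) j, Q.card :=
          Finset.sum_le_sum fun _ _ => Finset.card_image_le
      _ ≤ _ := by rw [Finset.sum_const, smul_eq_mul]; exact Nat.mul_le_mul_right _ ih

/-- Sums of `r` points of a structured Cantor iteration are points of the structured Cantor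
iteration whose digits are the sums of `r` digits. -/
lemma sum_mem_endpoints_const {P Q : Finset ℕ} {r : ℕ}
    (hQ : ∀ d : Fin r → ℕ, (∀ i, d i ∈ P) → ∑ i, d i ∈ Q) (j : ℕ) (a : Fin r → ℝ)
    (ha : ∀ i, a i ∈ endpoints N (fun _ _ => P) j) :
    ∑ i, a i ∈ endpoints N (fun _ _ => Q) j := by
  induction j generalizing a with
  | zero =>
    have : ∀ i, a i = 0 := by simpa [endpoints] using ha
    simp [endpoints, this]
  | succ j ih =>
    choose b hb d hd h using fun i => mem_endpoints_succ.1 (ha i)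
    refine mem_endpoints_succ.2 ⟨∑ i, b i, ih b hb, ∑ i, d i, hQ d hd, ?_⟩
    simp only [← h, Finset.sum_add_distrib, Nat.cast_sum, Finset.sum_div]

/-- Additive structure enters here: an `r`-fold sumset of a progression lies in a progression with
the same step. -/
lemma IsArithProg.exists_sum_mem {P : Finset ℕ} {L : ℕ} (hP : IsArithProg P L) {r : ℕ} (hr : 0 < r) :
    ∃ Q : Finset ℕ, Q.card ≤ r * L ∧
      ∀ d : Fin r → ℕ, (∀ i, d i ∈ P) → ∑ i, d i ∈ Q := by
  obtain ⟨x, s, -, rfl⟩ := hP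
  refine ⟨(Finset.range (r * L)).image fun i => r * x + i * s,
    Finset.card_image_le.trans (Finset.card_range _).le, fun d hd => ?_⟩
  choose k hk h using fun i => Finset.mem_image.1 (hd i)
  refine Finset.mem_image.2 ⟨∑ i, k i, ?_, ?_⟩
  · have : Nonempty (Fin r) := ⟨⟨0, hr⟩⟩
    have := Finset.sum_lt_sum_of_nonempty (s := (Finset.univ : Finset (Fin r)))
      Finset.univ_nonempty fun i _ => Finset.mem_range.1 (hk i)
    simpa using this
  · simp [← h, Finset.sum_add_distrib, Finset.sum_mul]

/-! ### Branches of the tree of choices and their ends. -/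

/-- The `i`-th element of `s` in increasing order, if `s` has `t` elements. -/
noncomputable def digit (s : Finset ℕ) (i : Fin t) : ℕ :=
  -- The default `0` never occurs along branches of an admissible iteration.
  if h : s.card = t then s.orderEmbOfFin h i else 0

/-- The points of the Cantor iteration visited by the branch `ω` of the tree of choices. -/
noncomputable def path (N : ℕ) (D : ℕ → ℝ → Finset ℕ) (ω : ℕ → Fin t) : ℕ → ℝ
  | 0 => 0
  | j + 1 => path N D ω j + (digit (D j (path N D ω j)) (ω j) : ℝ) / (N : ℝ) ^ (j + 1)

lemma path_congr {ω ω' : ℕ → Fin t} {j : ℕ} (h : ∀ i < j, ω i = ω' i) :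
    path N D ω j = path N D ω' j := by
  induction j with
  | zero => rfl
  | succ j ih =>
    rw [path, path, ih fun i hi => h i (hi.trans j.lt_succ_self), h j j.lt_succ_self]

lemma digit_mem {s : Finset ℕ} (hs : s.card = t) (i : Fin t) : digit s i ∈ s := by
  rw [digit, dif_pos hs]
  exact s.orderEmbOfFin_mem hs i

lemma digit_strictMono {s : Finset ℕ} (hs : s.card = t) : StrictMono (digit (t := t) s) := by
  intro i j hij
  simpa [digit, hs] using hij

lemma exists_digit_eq {s : Finset ℕ} (hs : s.card = t) {d : ℕ} (hd : d ∈ s) :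
    ∃ i : Fin t, digit s i = d := by
  have : d ∈ Set.range (s.orderEmbOfFin hs) := by simpa using hd
  obtain ⟨i, hi⟩ := this
  exact ⟨i, by rw [digit, dif_pos hs, hi]⟩

lemma path_mem (hD : Admissible N t D) (ω : ℕ → Fin t) (j : ℕ) :
    path N D ω j ∈ endpoints N D j := by
  induction j with
  | zero => simp [path, endpoints]
  | succ j ih => exact mem_endpoints_succ.2 ⟨_, ih, _, digit_mem (hD j _ ih).2 _, rfl⟩

lemma exists_path_eq [NeZero t] (hD : Admissible N t D) {j : ℕ} {a : ℝ}
    (ha : a ∈ endpoints N D j) : ∃ ω : ℕ → Fin t, path N D ω j = a := by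
  induction j generalizing a with
  | zero => exact ⟨fun _ => 0, by simpa [endpoints, path, eq_comm] using ha⟩
  | succ j ih =>
    obtain ⟨b, hb, d, hd, rfl⟩ := mem_endpoints_succ.1 ha
    obtain ⟨ω, rfl⟩ := ih hb
    obtain ⟨i, hi⟩ := exists_digit_eq (hD j _ hb).2 hd
    refine ⟨Function.update ω j i, ?_⟩
    have : path N D (Function.update ω j i) j = path N D ω j :=
      path_congr fun k hk => Function.update_of_ne hk.ne _ _
    rw [path, this, Function.update_self, hi]

/-- Only the first `j` coordinates matter, and they range over a finite set. -/
lemma measurable_path [NeZero t] (j : ℕ) :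
    Measurable fun ω : ℕ → Fin t => path N D ω j := by
  have h : (fun ω : ℕ → Fin t => path N D ω j) =
      (fun w : Fin j → Fin t => path N D (fun i => if h : i < j then w ⟨i, h⟩ else 0) j) ∘
        fun ω i => ω i := by
    ext ω
    exact path_congr fun i hi => by simp [hi]
  rw [h]
  exact (measurable_of_finite _).comp (by fun_prop)

lemma monotone_path (ω : ℕ → Fin t) : Monotone (path N D ω) :=
  monotone_nat_of_le_succ fun j => by rw [path]; exact le_add_of_nonneg_right (by positivity)

lemma path_succ_add (hN : 0 < N) (ω : ℕ → Fin t) (j : ℕ) :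
    path N D ω (j + 1) + ((N : ℝ) ^ (j + 1))⁻¹ = path N D ω j + ((N : ℝ) ^ j)⁻¹ -
      (N - 1 - digit (D j (path N D ω j)) (ω j)) / (N : ℝ) ^ (j + 1) := by
  have hN0 : (N : ℝ) ≠ 0 := by positivity
  rw [path]
  field_simp
  ring

lemma digit_le (hD : Admissible N t D) (ω : ℕ → Fin t) (j : ℕ) (i : Fin t) :
    (digit (D j (path N D ω j)) i : ℝ) ≤ N - 1 := by
  have hm := hD j _ (path_mem hD ω j)
  have := Finset.mem_range.1 (hm.1 (digit_mem hm.2 i))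
  have : ((digit (D j (path N D ω j)) i + 1 : ℕ) : ℝ) ≤ N := by exact_mod_cast this
  push_cast at this
  linarith

/-- With `monotone_path`, this says that the cells along a branch are nested. -/
lemma antitone_path_add (hN : 0 < N) (hD : Admissible N t D) (ω : ℕ → Fin t) :
    Antitone fun j => path N D ω j + ((N : ℝ) ^ j)⁻¹ :=
  antitone_nat_of_succ_le fun j => by
    rw [path_succ_add hN]
    have := digit_le hD ω j (ω j)
    exact sub_le_self _ (div_nonneg (by linarith) (by positivity))

/-- The end of the branch `ω` of the tree of choices. -/
noncomputable def pathLimit (N : ℕ) (D : ℕ → ℝ → Finset ℕ) (ω : ℕ → Fin t) : ℝ :=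
  ⨆ j, path N D ω j

lemma path_le (hN : 0 < N) (hD : Admissible N t D) (ω : ℕ → Fin t) (j k : ℕ) :
    path N D ω k ≤ path N D ω j + ((N : ℝ) ^ j)⁻¹ := by
  calc path N D ω k ≤ path N D ω (max j k) := monotone_path ω (le_max_right _ _)
    _ ≤ path N D ω (max j k) + ((N : ℝ) ^ (max j k))⁻¹ := le_add_of_nonneg_right (by positivity)
    _ ≤ _ := antitone_path_add hN hD ω (le_max_left _ _)

lemma bddAbove_path (hN : 0 < N) (hD : Admissible N t D) (ω : ℕ → Fin t) :
    BddAbove (Set.range (path N D ω)) :=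
  ⟨_, Set.forall_mem_range.2 fun k => path_le hN hD ω 0 k⟩

lemma tendsto_path (hN : 0 < N) (hD : Admissible N t D) (ω : ℕ → Fin t) :
    Tendsto (path N D ω) atTop (𝓝 (pathLimit N D ω)) :=
  tendsto_atTop_ciSup (monotone_path ω) (bddAbove_path hN hD ω)

lemma path_le_pathLimit (hN : 0 < N) (hD : Admissible N t D) (ω : ℕ → Fin t) (j : ℕ) :
    path N D ω j ≤ pathLimit N D ω :=
  le_ciSup (bddAbove_path hN hD ω) j

lemma pathLimit_le (hN : 0 < N) (hD : Admissible N t D) (ω : ℕ → Fin t) (j : ℕ) :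
    pathLimit N D ω ≤ path N D ω j + ((N : ℝ) ^ j)⁻¹ :=
  ciSup_le fun k => path_le hN hD ω j k

/-- Only the rightmost branch below a point ends at the right end of the cell of that point. -/
lemma forall_le_of_pathLimit_eq (hN : 0 < N) (hD : Admissible N t D) {ω : ℕ → Fin t} {j : ℕ}
    (h : pathLimit N D ω = path N D ω j + ((N : ℝ) ^ j)⁻¹) {k : ℕ} (hk : j ≤ k) (i : Fin t) :
    i ≤ ω k := by
  have h1 := pathLimit_le hN hD ω (k + 1)
  have h2 := antitone_path_add hN hD ω hk
  have h3 := path_succ_add (D := D) hN ω k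
  have hm := hD k _ (path_mem hD ω k)
  by_contra! hi
  -- A choice that is not the largest has digit below `N - 1`, so the right end of the cell strictly
  -- decreases and can no longer be reached.
  have h4 := digit_strictMono hm.2 hi
  have h5 := digit_le hD ω k i
  have h6 : (digit (D k (path N D ω k)) (ω k) : ℝ) < digit (D k (path N D ω k)) i := by
    exact_mod_cast h4
  have h7 : 0 < (N - 1 - (digit (D k (path N D ω k)) (ω k) : ℝ)) / (N : ℝ) ^ (k + 1) :=
    div_pos (by linarith) (by positivity)
  simp only at h2
  linarith

lemma measurable_pathLimit [NeZero t] (hN : 0 < N) (hD : Admissible N t D) :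
    Measurable fun ω : ℕ → Fin t => pathLimit N D ω :=
  measurable_of_tendsto_metrizable (fun j => measurable_path j)
    (tendsto_pi_nhds.2 fun ω => tendsto_path hN hD ω)

end CantorRestriction

/-! ### The limit measure as the law of a random branch. -/

namespace CantorRestriction

variable {N t : ℕ} {D : ℕ → ℝ → Finset ℕ}

/-- The law of a sequence of independent uniform elements of `Fin t`. -/
noncomputable def branchMeasure (t : ℕ) [NeZero t] : Measure (ℕ → Fin t) :=
  Measure.infinitePi fun _ => (PMF.uniformOfFintype (Fin t)).toMeasure

instance [NeZero t] : IsProbabilityMeasure (branchMeasure t) := by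
  rw [branchMeasure]; infer_instance

lemma branchMeasure_cylinder [NeZero t] (s : Finset ℕ) (w : ℕ → Fin t) :
    branchMeasure t {ω | ∀ i ∈ s, ω i = w i} = (t : ENNReal)⁻¹ ^ s.card := by
  have : {ω : ℕ → Fin t | ∀ i ∈ s, ω i = w i} = Set.pi s fun i => {w i} := by
    ext ω; simp
  rw [this, branchMeasure, Measure.infinitePi_pi _ fun i _ => measurableSet_singleton _]
  simp

lemma branchMeasure_eventually_eq [NeZero t] (ht : 1 < t) (j : ℕ) (w : ℕ → Fin t) :
    branchMeasure t {ω | ∀ k, j ≤ k → ω k = w k} = 0 := by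
  have h : ∀ n : ℕ, branchMeasure t {ω | ∀ k, j ≤ k → ω k = w k} ≤ (t : ENNReal)⁻¹ ^ n := by
    intro n
    calc _ ≤ branchMeasure t {ω | ∀ i ∈ Finset.Ico j (j + n), ω i = w i} :=
          measure_mono (by intro ω hω i hi; exact hω i (Finset.mem_Ico.1 hi).1)
      _ = _ := by rw [branchMeasure_cylinder]; simp
  have h1 : (t : ENNReal)⁻¹ < 1 := ENNReal.inv_lt_one.2 (by exact_mod_cast ht)
  exact le_antisymm (ge_of_tendsto' (ENNReal.tendsto_pow_atTop_nhds_zero_of_lt_one h1) h) zero_le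

instance [NeZero t] (j : ℕ) :
    IsProbabilityMeasure ((branchMeasure t).map fun ω => path N D ω j) :=
  Measure.isProbabilityMeasure_map (measurable_path j).aemeasurable

/-- Each point of the `j`-th level is visited with the same probability. -/
lemma map_path_singleton [NeZero t] (hN : 0 < N) (hD : Admissible N t D) {j : ℕ} {a : ℝ}
    (ha : a ∈ endpoints N D j) :
    ((branchMeasure t).map fun ω => path N D ω j).real {a} = ((t : ℝ) ^ j)⁻¹ := by
  set κ := (branchMeasure t).map fun ω => path N D ω j with hκ
  -- A cylinder gives the lower bound `t ^ (-j)` for every point; the `t ^ j` masses sum to `1`,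
  -- which forces equality.
  have hle : ∀ b ∈ endpoints N D j, ((t : ℝ) ^ j)⁻¹ ≤ κ.real {b} := by
    intro b hb
    obtain ⟨w, hw⟩ := exists_path_eq hD hb
    have h1 : (t : ENNReal)⁻¹ ^ j ≤ κ {b} := by
      rw [hκ, Measure.map_apply (measurable_path j) (measurableSet_singleton b)]
      calc (t : ENNReal)⁻¹ ^ j = branchMeasure t {ω | ∀ i ∈ Finset.range j, ω i = w i} := by
            rw [branchMeasure_cylinder, Finset.card_range]
        _ ≤ _ := measure_mono <| by
            intro ω hω
            have : path N D ω j = path N D w j :=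
              path_congr fun i hi => hω i (Finset.mem_range.2 hi)
            simp [this, hw]
    have h2 := ENNReal.toReal_mono (measure_ne_top κ {b}) h1
    simpa [Measure.real] using h2
  have hsum : ∑ b ∈ endpoints N D j, κ.real {b} = ∑ b ∈ endpoints N D j, ((t : ℝ) ^ j)⁻¹ := by
    have ht : (t : ℝ) ≠ 0 := by exact_mod_cast NeZero.ne t
    rw [Finset.sum_const, card_endpoints hN hD, sum_measureReal_singleton, nsmul_eq_mul]
    push_cast
    rw [mul_inv_cancel₀ (pow_ne_zero _ ht)]
    have : κ (endpoints N D j) = 1 := by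
      rw [hκ, Measure.map_apply (measurable_path j) (Finset.measurableSet _)]
      have : (fun ω : ℕ → Fin t => path N D ω j) ⁻¹' (endpoints N D j) = Set.univ :=
        Set.eq_univ_of_forall fun ω => path_mem hD ω j
      rw [this, measure_univ]
    simp [Measure.real, this]
  exact ((Finset.sum_eq_sum_iff_of_le hle).1 hsum.symm a ha).symm

lemma integral_path [NeZero t] (hN : 0 < N) (hD : Admissible N t D) (j : ℕ) {g : ℝ → ℝ}
    (hg : Continuous g) :
    ∫ ω, g (path N D ω j) ∂(branchMeasure t) =
      ∑ a ∈ endpoints N D j, ((t : ℝ) ^ j)⁻¹ * g a := by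
  set κ := (branchMeasure t).map fun ω => path N D ω j with hκ
  have h1 : ∫ ω, g (path N D ω j) ∂(branchMeasure t) = ∫ x, g x ∂κ :=
    (integral_map (measurable_path j).aemeasurable hg.aestronglyMeasurable).symm
  have h2 : κ.restrict (endpoints N D j) = κ := by
    refine Measure.restrict_eq_self_of_ae_mem ?_
    exact (ae_map_iff (p := fun y => y ∈ (endpoints N D j : Set ℝ))
      (measurable_path j).aemeasurable (Finset.measurableSet _)).2
      (Eventually.of_forall fun ω => path_mem hD ω j)
  rw [h1, ← h2, setIntegral_finset _
    (hg.continuousOn.integrableOn_compact (Finset.finite_toSet _).isCompact)]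
  exact Finset.sum_congr rfl fun a ha => by rw [map_path_singleton hN hD ha, smul_eq_mul]

lemma approxMeasure_eq_sum (j : ℕ) :
    approxMeasure N t D j = ∑ a ∈ endpoints N D j,
      ENNReal.ofReal (((t : ℝ) ^ j)⁻¹ * (N : ℝ) ^ j) •
        (volume : Measure ℝ).restrict (Set.Icc a (a + ((N : ℝ) ^ j)⁻¹)) := by
  ext s hs
  rw [approxMeasure, withDensity_apply _ hs, lintegral_finsetSum _ fun a _ =>
    measurable_const.indicator measurableSet_Icc, Measure.finsetSum_apply]
  refine Finset.sum_congr rfl fun a _ => ?_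
  rw [lintegral_indicator_const measurableSet_Icc, Measure.smul_apply, smul_eq_mul,
    Measure.restrict_apply hs, Measure.restrict_apply measurableSet_Icc, Set.inter_comm]

/-- Realizes every `μ_j` as a branch point plus an independent uniform shift of size `N ^ (-j)`, so
that all of them live over one probability space and dominated convergence gives the weak limit. -/
lemma integral_approxMeasure [NeZero t] (hN : 0 < N) (hD : Admissible N t D) (j : ℕ)
    (g : ℝ →ᵇ ℝ) :
    ∫ x, g x ∂(approxMeasure N t D j) =
      ∫ ω, (∫ v in (0 : ℝ)..1, g (path N D ω j + ((N : ℝ) ^ j)⁻¹ * v)) ∂(branchMeasure t) := by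
  have hc : Continuous fun x : ℝ => ∫ v in (0 : ℝ)..1, g (x + ((N : ℝ) ^ j)⁻¹ * v) :=
    intervalIntegral.continuous_parametric_intervalIntegral_of_continuous' (by fun_prop) _ _
  have hN0 : (N : ℝ) ^ j ≠ 0 := by positivity
  rw [integral_path hN hD j hc, approxMeasure_eq_sum, integral_finsetSum_measure]
  · refine Finset.sum_congr rfl fun a _ => ?_
    rw [integral_smul_measure, ENNReal.toReal_ofReal (by positivity),
      integral_Icc_eq_integral_Ioc, ← intervalIntegral.integral_of_le
        (le_add_of_nonneg_right (by positivity)),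
      intervalIntegral.integral_comp_add_mul _ (inv_ne_zero hN0)]
    simp [mul_assoc]
  · intro a _
    refine Integrable.smul_measure ?_ ENNReal.ofReal_ne_top
    exact g.continuous.integrableOn_Icc

/-- The law of the end of a random branch. -/
noncomputable def limitMeasure (N t : ℕ) [NeZero t] (D : ℕ → ℝ → Finset ℕ) : Measure ℝ :=
  (branchMeasure t).map fun ω => pathLimit N D ω

lemma isWeakLimit_limitMeasure [NeZero t] (hN : 1 < N) (hD : Admissible N t D) :
    IsWeakLimit N t D (limitMeasure N t D) := by
  have hN' : 0 < N := by lia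
  refine ⟨Measure.isProbabilityMeasure_map (measurable_pathLimit hN' hD).aemeasurable,
    fun g => ?_⟩
  rw [limitMeasure, integral_map (measurable_pathLimit hN' hD).aemeasurable
    g.continuous.aestronglyMeasurable]
  simp_rw [integral_approxMeasure hN' hD]
  have hbd : ∀ x : ℝ, ∀ j : ℕ,
      ‖∫ v in (0 : ℝ)..1, g (x + ((N : ℝ) ^ j)⁻¹ * v)‖ ≤ ‖g‖ := by
    intro x j
    have := intervalIntegral.norm_integral_le_of_norm_le_const (a := (0 : ℝ)) (b := 1) (C := ‖g‖)
      (f := fun v => g (x + ((N : ℝ) ^ j)⁻¹ * v)) fun v _ => g.norm_coe_le_norm _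
    simpa using this
  refine tendsto_integral_of_dominated_convergence (fun _ => ‖g‖) (fun j => ?_)
    (integrable_const _) (fun j => Eventually.of_forall fun ω => hbd _ j)
    (Eventually.of_forall fun ω => ?_)
  · have hc : Continuous fun x : ℝ => ∫ v in (0 : ℝ)..1, g (x + ((N : ℝ) ^ j)⁻¹ * v) :=
      intervalIntegral.continuous_parametric_intervalIntegral_of_continuous' (by fun_prop) _ _
    exact (hc.measurable.comp (measurable_path j)).aestronglyMeasurable
  · have h1 : g (pathLimit N D ω) = ∫ _v in (0 : ℝ)..1, g (pathLimit N D ω) := by simp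
    rw [h1]
    refine intervalIntegral.tendsto_integral_filter_of_dominated_convergence (fun _ => ‖g‖)
      (Eventually.of_forall fun j => Continuous.aestronglyMeasurable (by fun_prop))
      (Eventually.of_forall fun j => Eventually.of_forall fun v _ => g.norm_coe_le_norm _)
      (by simp) (Eventually.of_forall fun v _ => ?_)
    refine (g.continuous.tendsto _).comp ?_
    have h2 : Tendsto (fun j : ℕ => ((N : ℝ) ^ j)⁻¹) atTop (𝓝 0) := by
      simp_rw [← inv_pow]
      exact tendsto_pow_atTop_nhds_zero_of_lt_one (by positivity)
        (inv_lt_one_of_one_lt₀ (by exact_mod_cast hN))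
    simpa using (tendsto_path hN' hD ω).add (h2.mul_const v)

lemma measurableSet_structuredSet (P : Finset ℕ) (l : ℕ) : MeasurableSet (structuredSet N P l) :=
  Finset.measurableSet_biUnion _ fun _ _ => measurableSet_Ico

/-- The limit measure gives mass at least `t ^ (-l)` times the number of cells to `F_l`. -/
lemma le_limitMeasure_structuredSet [NeZero t] (hN : 0 < N) (ht : 1 < t) (hD : Admissible N t D)
    {P : Finset ℕ} {l : ℕ} (hP : structuredEndpoints N P l ⊆ endpoints N D l) :
    (structuredEndpoints N P l).card * ((t : ℝ) ^ l)⁻¹ ≤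
      (limitMeasure N t D).real (structuredSet N P l) := by
  set κ := (branchMeasure t).map fun ω => path N D ω l with hκ
  have h1 : (structuredEndpoints N P l).card * ((t : ℝ) ^ l)⁻¹ =
      κ.real (structuredEndpoints N P l) := by
    rw [← sum_measureReal_singleton,
      Finset.sum_congr rfl fun a ha => map_path_singleton hN hD (hP ha)]
    simp
  rw [h1, hκ, map_measureReal_apply (measurable_path l) (Finset.measurableSet _), limitMeasure,
    map_measureReal_apply (measurable_pathLimit hN hD) (measurableSet_structuredSet P l)]
  refine ENNReal.toReal_mono (measure_ne_top _ _) (measure_mono_ae ?_)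
  have hnull : ∀ᵐ ω ∂(branchMeasure t), pathLimit N D ω ≠ path N D ω l + ((N : ℝ) ^ l)⁻¹ := by
    rw [ae_iff]
    -- Cells are half-open; ending at a right endpoint requires the largest choice `⊤` from level
    -- `l` on, a null event as `1 < t`.
    refine measure_mono_null ?_ (branchMeasure_eventually_eq ht l fun _ => ⊤)
    intro ω hω k hk
    have := forall_le_of_pathLimit_eq hN hD (not_not.1 hω) hk
    exact top_unique (this ⊤)
  filter_upwards [hnull] with ω hω hmem
  exact Set.mem_biUnion (x := path N D ω l) hmem ⟨path_le_pathLimit hN hD ω l,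
    lt_of_le_of_ne (pathLimit_le hN hD ω l) hω⟩

end CantorRestriction

/-! ### From the sumset estimate to the `L ^ p` bound. -/

namespace CantorRestriction

variable {N : ℕ}

lemma fourierMeas_structuredFun (P : Finset ℕ) (l : ℕ) (μ : Measure ℝ) :
    fourierMeas (structuredFun N P l) μ = Fourier.fourierIntegral Real.fourierChar
      (μ.restrict (structuredSet N P l)) fun _ => (1 : ℂ) := by
  ext ξ
  rw [fourierMeas, Fourier.fourierIntegral_def, Fourier.fourierIntegral_def,
    ← integral_indicator (measurableSet_structuredSet P l)]
  congr 1 with v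
  by_cases hv : v ∈ structuredSet N P l <;> simp [structuredFun, hv]

lemma lintegral_enorm_fourier_pow_le (ν : Measure ℝ) [IsFiniteMeasure ν] (n : ℕ) {p : ℝ}
    (hp0 : 0 ≤ p) (hp : p ≤ n) :
    ∫⁻ ξ, ‖Fourier.fourierIntegral Real.fourierChar ν (fun _ => (1 : ℂ)) ξ‖ₑ ^ n ≤
      ν Set.univ ^ (n - p) *
        ∫⁻ ξ, ‖Fourier.fourierIntegral Real.fourierChar ν (fun _ => (1 : ℂ)) ξ‖ₑ ^ p := by
  set F := Fourier.fourierIntegral Real.fourierChar ν (fun _ => (1 : ℂ)) with hF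
  have hle : ∀ ξ, ‖F ξ‖ₑ ≤ ν Set.univ := by
    intro ξ
    calc ‖F ξ‖ₑ ≤ ∫⁻ v, ‖Real.fourierChar (-(v * ξ)) • (1 : ℂ)‖ₑ ∂ν :=
          enorm_integral_le_lintegral_enorm _
      _ = ν Set.univ := by
          rw [← lintegral_one]
          congr 1 with v
          rw [← ofReal_norm, Circle.norm_smul]
          simp
  rw [← lintegral_const_mul' _ _ (ENNReal.rpow_ne_top_of_nonneg (by linarith) (measure_ne_top _ _))]
  refine lintegral_mono fun ξ => ?_
  calc ‖F ξ‖ₑ ^ n = ‖F ξ‖ₑ ^ ((n - p) + p) := by rw [sub_add_cancel, ENNReal.rpow_natCast]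
    _ = ‖F ξ‖ₑ ^ (n - p) * ‖F ξ‖ₑ ^ p := ENNReal.rpow_add_of_nonneg _ _ (by linarith) hp0
    _ ≤ _ := by gcongr; exact hle ξ

/-- The sums of `r` points of `F_l` lie in a closed set with a small neighbourhood. -/
lemma exists_sum_mem_structuredSet (hN : 0 < N) {P : Finset ℕ} {L : ℕ} (hP : IsArithProg P L)
    {r : ℕ} (hr : 0 < r) (l : ℕ) :
    ∃ E U : Set ℝ, IsClosed E ∧ IsOpen U ∧ E ⊆ U ∧ Bornology.IsBounded U ∧
      (∀ x : Fin r → ℝ, (∀ i, x i ∈ structuredSet N P l) → ∑ i, x i ∈ E) ∧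
      volume U ≤ ENNReal.ofReal ((r * L : ℝ) ^ l * ((r + 2) * ((N : ℝ) ^ l)⁻¹)) := by
  obtain ⟨Q, hQ, hsum⟩ := hP.exists_sum_mem hr
  set δ : ℝ := ((N : ℝ) ^ l)⁻¹ with hδ
  have hδ0 : 0 < δ := by positivity
  set T := endpoints N (fun _ _ => Q) l with hT
  -- A margin `δ` on each side turns intervals of length `r * δ` into open ones of length `(r + 2) *
  -- δ`.
  refine ⟨⋃ s ∈ T, Set.Icc s (s + r * δ), ⋃ s ∈ T, Set.Ioo (s - δ) (s + (r + 1) * δ),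
    T.finite_toSet.isClosed_biUnion fun _ _ => isClosed_Icc,
    isOpen_biUnion fun _ _ => isOpen_Ioo, ?_, ?_, ?_, ?_⟩
  · refine Set.biUnion_mono subset_rfl fun s _ => Set.Icc_subset_Ioo (by linarith) (by linarith)
  · exact (Bornology.isBounded_biUnion T.finite_toSet).2 fun s _ => Metric.isBounded_Ioo _ _
  · intro x hx
    have hx' : ∀ i, ∃ a ∈ structuredEndpoints N P l, x i ∈ Set.Ico a (a + δ) := fun i => by
      simpa only [structuredSet, Set.mem_iUnion₂, exists_prop] using hx i
    choose a ha hxa using hx'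
    refine Set.mem_biUnion (x := ∑ i, a i) (sum_mem_endpoints_const hsum l a ha)
      ⟨Finset.sum_le_sum fun i _ => (hxa i).1, ?_⟩
    calc ∑ i, x i ≤ ∑ i, (a i + δ) := Finset.sum_le_sum fun i _ => (hxa i).2.le
      _ = _ := by simp [Finset.sum_add_distrib]
  · calc _ ≤ ∑ s ∈ T, volume (Set.Ioo (s - δ) (s + (r + 1) * δ)) := measure_biUnion_finset_le _ _
      _ = T.card * ENNReal.ofReal ((r + 2) * δ) := by
          rw [Finset.sum_congr rfl fun s _ => Real.volume_Ioo, Finset.sum_congr rfl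
            (g := fun _ => ENNReal.ofReal ((r + 2) * δ)) fun s _ => by ring_nf,
            Finset.sum_const, nsmul_eq_mul]
      _ = ENNReal.ofReal (T.card * ((r + 2) * δ)) := by
          rw [ENNReal.ofReal_mul (Nat.cast_nonneg T.card), ENNReal.ofReal_natCast]
      _ ≤ _ := by
          refine ENNReal.ofReal_le_ofReal (mul_le_mul_of_nonneg_right ?_ (by positivity))
          have : T.card ≤ (r * L) ^ l :=
            (card_endpoints_const_le Q l).trans (Nat.pow_le_pow_left hQ l)
          exact_mod_cast this

/-- The `L ^ p` norm of the Fourier transform of `f_l dμ` in terms of the mass of `f_l dμ`. -/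
lemma measure_structuredSet_rpow_le (hN : 0 < N) {P : Finset ℕ} {L : ℕ} (hP : IsArithProg P L)
    {r : ℕ} (hr : 0 < r) (l : ℕ) (μ : Measure ℝ) [IsFiniteMeasure μ] {p : ℝ} (hp0 : 0 ≤ p)
    (hp : p ≤ 2 * r) (hμ : μ (structuredSet N P l) ≠ 0) :
    μ (structuredSet N P l) ^ p ≤
      ENNReal.ofReal ((r * L : ℝ) ^ l * ((r + 2) * ((N : ℝ) ^ l)⁻¹)) *
        ∫⁻ ξ, ‖fourierMeas (structuredFun N P l) μ ξ‖ₑ ^ p := by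
  obtain ⟨E, U, hE, hU, hEU, hb, hsum, hvol⟩ := exists_sum_mem_structuredSet hN hP hr l
  rw [fourierMeas_structuredFun]
  set ν := μ.restrict (structuredSet N P l) with hν
  have hνu : ν Set.univ = μ (structuredSet N P l) := Measure.restrict_apply_univ _
  rw [← hνu] at hμ ⊢
  have h1 := measure_univ_pow_le ν r hE hU hEU hb
    (ae_restrict_mem (measurableSet_structuredSet P l)) hsum
  have h2 := lintegral_enorm_fourier_pow_le ν (2 * r) hp0 (by push_cast; exact hp)
  set I := ∫⁻ ξ, ‖Fourier.fourierIntegral Real.fourierChar ν (fun _ => (1 : ℂ)) ξ‖ₑ ^ p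
  set m := ν Set.univ
  set q : ℝ := ((2 * r : ℕ) : ℝ) - p with hq
  have hq0 : 0 ≤ q := by rw [hq]; push_cast; linarith
  have hmtop : m ≠ ⊤ := measure_ne_top _ _
  have hsplit : m ^ (2 * r) = m ^ q * m ^ p := by
    rw [← ENNReal.rpow_add_of_nonneg _ _ hq0 hp0, hq, sub_add_cancel, ENNReal.rpow_natCast]
  -- Cancels `m ^ (2 r - p)`, legitimate since `m` is neither zero nor infinite.
  refine (ENNReal.mul_le_mul_iff_right (a := m ^ q) ?_
    (ENNReal.rpow_ne_top_of_nonneg hq0 hmtop)).1 ?_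
  · simp [ENNReal.rpow_eq_zero_iff, hμ, hmtop]
  · rw [← hsplit, mul_left_comm]
    exact h1.trans (mul_le_mul' hvol h2)

/-- The `L ^ p` norm of the Fourier transform of `f_l dμ` is large if `μ` has mass at least
`L ^ (-l)` on `F_l`. -/
lemma le_eLpNorm_fourierMeas (hN : 0 < N) {P : Finset ℕ} {L : ℕ} (hL : 0 < L)
    (hP : IsArithProg P L) {r : ℕ} (hr : 2 ≤ r) (l : ℕ) (μ : Measure ℝ) [IsFiniteMeasure μ]
    {p : ℝ} (hp0 : 1 ≤ p) (hp : p ≤ 2 * r)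
    (hμ : ((L : ℝ) ^ l)⁻¹ ≤ μ.real (structuredSet N P l)) :
    ENNReal.ofReal (1 / 2 * ((N : ℝ) ^ l * ((r : ℝ) ^ (l + 1))⁻¹ /
        ((L : ℝ) ^ 2) ^ ((l : ℝ) * (p + 1) / 2))) ≤
      eLpNorm (fourierMeas (structuredFun N P l) μ) (ENNReal.ofReal p) volume ^ p := by
  have hr0 : 0 < r := by lia
  have hp1 : 0 < p := by linarith
  have hL0 : 0 < (L : ℝ) ^ l := by positivity
  have hm : ENNReal.ofReal ((L : ℝ) ^ l)⁻¹ ≤ μ (structuredSet N P l) := by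
    rw [← ofReal_measureReal]; exact ENNReal.ofReal_le_ofReal hμ
  have hm0 : μ (structuredSet N P l) ≠ 0 :=
    ((ENNReal.ofReal_pos.2 (inv_pos.2 hL0)).trans_le hm).ne'
  have h := measure_structuredSet_rpow_le hN hP hr0 l μ hp1.le hp hm0
  rw [eLpNorm_eq_lintegral_rpow_enorm_toReal (by simpa using hp1) ENNReal.ofReal_ne_top,
    ENNReal.toReal_ofReal hp1.le, ← ENNReal.rpow_mul, one_div_mul_cancel hp1.ne',
    ENNReal.rpow_one]
  set v : ℝ := (r * L : ℝ) ^ l * ((r + 2) * ((N : ℝ) ^ l)⁻¹) with hv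
  have hv0 : 0 < v := by positivity
  have h1 : ENNReal.ofReal ((((L : ℝ) ^ l)⁻¹) ^ p) ≤ ENNReal.ofReal v *
      ∫⁻ ξ, ‖fourierMeas (structuredFun N P l) μ ξ‖ₑ ^ p := by
    rw [← ENNReal.ofReal_rpow_of_nonneg (by positivity) hp1.le]
    exact (ENNReal.rpow_le_rpow hm hp1.le).trans h
  refine le_trans (ENNReal.ofReal_le_ofReal ?_)
    ((ENNReal.ofReal_div_of_pos hv0).trans_le (ENNReal.div_le_of_le_mul' h1))
  have hpow : ((L : ℝ) ^ 2) ^ ((l : ℝ) * (p + 1) / 2) = ((L : ℝ) ^ l) ^ p * (L : ℝ) ^ l := by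
    rw [← Real.rpow_natCast (L : ℝ) 2, ← Real.rpow_mul (by positivity),
      ← Real.rpow_natCast (L : ℝ) l, ← Real.rpow_mul (by positivity), ← Real.rpow_add (by positivity)]
    congr 1
    push_cast
    ring
  have hrr : (2 : ℝ) ≤ r := by exact_mod_cast hr
  have hLp : 0 < ((L : ℝ) ^ l) ^ p := by positivity
  rw [hpow, Real.inv_rpow hL0.le, hv, mul_pow, pow_succ]
  -- The factor `1 / 2` turns `r + 2` into `2 * r`, and `r + 2 ≤ 2 * r` because `2 ≤ r`.
  rw [show 1 / 2 * ((N : ℝ) ^ l * ((r : ℝ) ^ l * r)⁻¹ / (((L : ℝ) ^ l) ^ p * (L : ℝ) ^ l)) =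
    (((L : ℝ) ^ l) ^ p)⁻¹ / ((r : ℝ) ^ l * (L : ℝ) ^ l * (2 * r * ((N : ℝ) ^ l)⁻¹)) by
      field_simp]
  gcongr
  linarith

end CantorRestriction

/-! ### Assembly. -/

theorem proposition3p2 (r : ℕ) :
    ∃ C : ℝ, 0 < C ∧ ∃ nmin : ℕ,
      ∀ N₀ t₀ : ℕ, 1 < t₀ → t₀ < N₀ →
      1 / (Real.log (t₀ : ℝ) / Real.log (N₀ : ℝ)) < (r : ℝ) →
      ∀ n₀ : ℕ, nmin ≤ n₀ →
      ∀ N t : ℕ, N = N₀ ^ (2 * n₀) → t = t₀ ^ (2 * n₀) →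
      ∀ P : Finset ℕ, P ⊆ Finset.range N → CantorRestriction.IsArithProg P (t₀ ^ n₀) →
      ∀ D : ℕ → ℝ → Finset ℕ, CantorRestriction.Admissible N t D →
      (∀ j : ℕ, CantorRestriction.structuredEndpoints N P j ⊆
        CantorRestriction.endpoints N D j) →
      ∃ μ : Measure ℝ, CantorRestriction.IsWeakLimit N t D μ ∧
        ∀ p : ℝ, 1 ≤ p → p ≤ 2 * (r : ℝ) →
          ∀ᶠ l : ℕ in atTop,
            ENNReal.ofReal (C * ((N : ℝ) ^ l * ((r : ℝ) ^ (l + 1))⁻¹ /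
                (t : ℝ) ^ ((l : ℝ) * (p + 1) / 2))) ≤
              eLpNorm (CantorRestriction.fourierMeas
                (CantorRestriction.structuredFun N P l) μ) (ENNReal.ofReal p) volume ^ p := by
  refine ⟨1 / 2, by norm_num, 1, ?_⟩
  intro N₀ t₀ ht₀ hN₀ hr n₀ hn₀ N t hN ht P hPN hP D hD hPD
  have hN1 : 1 < N := hN ▸ one_lt_pow₀ (ht₀.trans hN₀) (by lia)
  have ht1 : 1 < t := ht ▸ one_lt_pow₀ ht₀ (by lia)
  have : NeZero t := ⟨by lia⟩
  -- As `t₀ < N₀`, the ratio `1 / α` exceeds `1`, hence so does the integer `r`.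
  have hr2 : 2 ≤ r := by
    have h1 : 0 < Real.log t₀ := Real.log_pos (by exact_mod_cast ht₀)
    have h2 : Real.log t₀ < Real.log N₀ :=
      Real.log_lt_log (by positivity) (by exact_mod_cast hN₀)
    have h3 : (1 : ℝ) < r := by
      refine lt_trans ?_ hr
      rw [one_div_div, one_lt_div h1]
      exact h2
    exact_mod_cast h3
  have hw := CantorRestriction.isWeakLimit_limitMeasure hN1 hD
  refine ⟨CantorRestriction.limitMeasure N t D, hw, fun p hp1 hp2 => Eventually.of_forall ?_⟩
  intro l
  have := hw.1
  have ht2 : (t : ℝ) = ((t₀ ^ n₀ : ℕ) : ℝ) ^ 2 := by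
    rw [ht]
    push_cast
    rw [← pow_mul, mul_comm 2]
  have hL : 0 < t₀ ^ n₀ := by positivity
  have hPcard : P.card = t₀ ^ n₀ := by
    obtain ⟨x, d, hd, rfl⟩ := hP
    rw [Finset.card_image_of_injective _ fun i j h => ?_, Finset.card_range]
    simpa [hd.ne'] using h
  -- The structured iteration is itself admissible, with `t₀ ^ n₀` children per point.
  have hcard : (CantorRestriction.structuredEndpoints N P l).card = (t₀ ^ n₀) ^ l :=
    CantorRestriction.card_endpoints (by lia) (fun _ _ _ => ⟨hPN, hPcard⟩) l
  have hmass := CantorRestriction.le_limitMeasure_structuredSet (by lia) ht1 hD (hPD l)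
  rw [ht2]
  refine CantorRestriction.le_eLpNorm_fourierMeas (by lia) hL hP hr2 l _ hp1 hp2 ?_
  refine le_of_eq_of_le ?_ hmass
  have : (((t₀ ^ n₀ : ℕ) : ℝ)) ≠ 0 := by exact_mod_cast hL.ne'
  rw [hcard, ht2]
  push_cast at this ⊢
  field_simp
  ring
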